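/- **Theorem 1.1.** Fix $d\in\mathbb N$ and $\epsilon>0$. Let $F$ be a probability distribution on $\mathbb R^d$ that is absolutely continuous with respect to Lebesgue measure and centrally symmetric about some point $c\in\mathbb R^d$ (invariant under $x\mapsto 2c-x$). For $m\ge 1$ and $n\ge 0$ consider $n$ i.i.d. labelled points $(x_1,y_1),\dots,(x_n,y_n)$, where $x_i\sim F$ and the label $y_i$ is independent of $x_i$ and uniform on $\{1,\dots,m\}$. For labels $j\ne k$ and a set $R\subseteq\{1,\dots,n\}$ of retained indices, let $I$ be the set of $i\in R$ with $y_i\in\{j,k\}$, and put $s_i=1$ if $y_i=j$ and $s_i=-1$ if $y_i=k$. We say that the MLE exists for the pair $(j,k)$ on $R$ if the logistic log-likelihood $$\sum_{i\in I}-\log\bigl(1+\exp(-s_i(b+x_i^{\top}\beta))\bigr)$$ attains its maximum, both over $\beta\in\mathbb R^d$ with $b=0$ (model without intercept) and over $(b,\beta)\in\mathbb R\times\mathbb R^d$ (model with intercept). 1. Let $f:\mathbb N\to\mathbb N$ satisfy $f(m)\ge(1+\epsilon)\,m\log_2(m)\,\ln(\ln m)$ for all sufficiently large $m$. Then, for $n=f(m)$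 data points with $m$ labels, the probability that the MLE exists for every pair of distinct labels on the whole data set tends to $1$ as $m\to\infty$. 2. Fix $m\ge1$ and let $g:\mathbb N\to\mathbb N$ satisfy $(1+\epsilon)\,t\le g(t)/m$ for all sufficiently large $t$ (in particular, this holds whenever $t=o(g(t)/m)$). Then, for $n=g(t)$ data points with $m$ labels, the probability that, for every set $T$ of at most $t$ data points, the MLE exists for every pair of distinct labels on the data remaining after the removal of $T$, tends to $1$ as $t\to\infty$. -/

import Mathlib

open MeasureTheory ProbabilityTheory Filter Topology

noncomputable section

namespace OneVsOne

/-- The log-likelihood of the binary logistic model with intercept `b` and coefficient vector `β`,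
for the observations `(x i, y i)`, `i ∈ s`, with responses `y i ∈ {-1, 1}`:
`∑ i ∈ s, -log (1 + exp (- y i * (b + ⟪x i, β⟫)))`. -/
def logLikelihood {ι : Type*} {d : ℕ} (s : Finset ι) (x : ι → EuclideanSpace ℝ (Fin d))
    (y : ι → ℝ) (b : ℝ) (β : EuclideanSpace ℝ (Fin d)) : ℝ :=
  ∑ i ∈ s, -Real.log (1 + Real.exp (-(y i * (b + inner ℝ (x i) β))))

/-- Existence of the MLE in the model without intercept, `P(y = 1 | x) = σ(⟪x, β⟫)`:
the log-likelihood has a maximizer `β`. -/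
def HasMLE {ι : Type*} {d : ℕ} (s : Finset ι) (x : ι → EuclideanSpace ℝ (Fin d))
    (y : ι → ℝ) : Prop :=
  ∃ β, ∀ β', logLikelihood s x y 0 β' ≤ logLikelihood s x y 0 β

/-- Existence of the MLE in the model with intercept, `P(y = 1 | x) = σ(b + ⟪x, β⟫)`:
the log-likelihood has a maximizer `(b, β)`. -/
def HasMLEIntercept {ι : Type*} {d : ℕ} (s : Finset ι) (x : ι → EuclideanSpace ℝ (Fin d))
    (y : ι → ℝ) : Prop :=
  ∃ b β, ∀ b' β', logLikelihood s x y b' β' ≤ logLikelihood s x y b β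

/-- A data set of `n` points of `ℝ^d`, each with one of `m` labels. -/
abbrev Data (d m n : ℕ) : Type := Fin n → EuclideanSpace ℝ (Fin d) × Fin m

/-- The indices in `R` of the data points labelled `j` or `k`. -/
def pairIndices {d m n : ℕ} (ω : Data d m n) (R : Finset (Fin n)) (j k : Fin m) :
    Finset (Fin n) :=
  R.filter fun i => (ω i).2 = j ∨ (ω i).2 = k

/-- The binary response that encodes label `j` as `1` and every other label as `-1`. -/
def response {d m n : ℕ} (ω : Data d m n) (j : Fin m) (i : Fin n) : ℝ :=
  if (ω i).2 = j then 1 else -1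

/-- One-vs-one regression on the data points with index in `R`: for every pair of distinct labels
`j`, `k`, the MLE exists for the points labelled `j` (response `1`) or `k` (response `-1`), both
in the model without intercept and in the model with intercept. -/
def AllPairsHaveMLE {d m n : ℕ} (ω : Data d m n) (R : Finset (Fin n)) : Prop :=
  ∀ j k : Fin m, j ≠ k →
    HasMLE (pairIndices ω R j k) (fun i => (ω i).1) (response ω j) ∧
      HasMLEIntercept (pairIndices ω R j k) (fun i => (ω i).1) (response ω j)

/-- The law of `n` i.i.d. labelled points `(x i, y i)`, where `x i` has distribution `F` and `y i`
is uniform on the `m` labels and independent of `x i`. -/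
def dataLaw {d : ℕ} (F : Measure (EuclideanSpace ℝ (Fin d))) (m n : ℕ) :
    Measure (Data d m n) :=
  Measure.pi fun _ => F.prod (uniformOn (Set.univ : Set (Fin m)))

/-- `F` is symmetric about some point `c`: it is invariant under `x ↦ 2c - x`. -/
def CentrallySymmetric {d : ℕ} (F : Measure (EuclideanSpace ℝ (Fin d))) : Prop :=
  ∃ c : EuclideanSpace ℝ (Fin d), F.map (fun x => (2 : ℝ) • c - x) = F

end OneVsOne

end

namespace OneVsOne

/-! ### Existence of the maximum likelihood estimate -/

/-! The MLE exists as soon as every nonzero affine function strictly misclassifies some retained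
point. Almost surely the points are in general position, so a nonzero affine function can be nudged
off its zeros, and what matters is only the set `A` of points on its positive side. By Sauer–Shelah
there are at most `(d + 2) * (n + 1) ^ (d + 1)` such sets (`card_signPatterns_le`), and they depend
on the points alone. For fixed `A` and labels `j`, `k`, the misclassified points are those labelled
`k` in `A` or `j` outside `A`: each index qualifies independently with probability `1 / m`, so by
Chernoff (`measure_card_mem_le`) it is unlikely that at most `t` do. If more than `t` do, one
survives any deletion of `t` points.

A union bound over `j`, `k`, `A` gives `dataLaw_compl_le`, a polynomial factor times `exp (l * t - n
/ m * (l / (1 + l)))`, with `l` free. Both limits follow by choosing `l`. -/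

theorem max_zero_le_log_one_add_exp (u : ℝ) : max 0 u ≤ Real.log (1 + Real.exp u) := by
  refine max_le (Real.log_nonneg (by linarith [Real.exp_pos u])) ?_
  rw [Real.le_log_iff_exp_le (by positivity)]
  linarith

/-- A logistic loss attains its minimum if no direction separates the observations weakly. -/
theorem exists_forall_logisticLoss_le {ι V : Type*} [NormedAddCommGroup V] [NormedSpace ℝ V]
    [FiniteDimensional ℝ V] (s : Finset ι) (a : ι → V →L[ℝ] ℝ)
    (h : ∀ w ≠ 0, ∃ i ∈ s, a i w < 0) :
    ∃ w, ∀ w', ∑ i ∈ s, Real.log (1 + Real.exp (-(a i w))) ≤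
      ∑ i ∈ s, Real.log (1 + Real.exp (-(a i w'))) := by
  have : ProperSpace V := FiniteDimensional.proper ℝ V
  have hcont : Continuous fun w => ∑ i ∈ s, Real.log (1 + Real.exp (-(a i w))) := by
    refine continuous_finsetSum _ fun i _ => Continuous.log (by fun_prop) fun w => ?_
    positivity
  -- Coercivity: the loss dominates a positively homogeneous function that is positive on the
  -- compact unit sphere, hence dominates `δ * ‖w‖`.
  have hpos : ∀ w ∈ Metric.sphere (0 : V) 1, 0 < ∑ i ∈ s, max 0 (-(a i w)) := by
    intro w hw
    have hw0 : w ≠ 0 := fun h0 => by simp [h0] at hw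
    obtain ⟨i, hi, hneg⟩ := h w hw0
    exact Finset.sum_pos' (fun _ _ => le_max_left _ _) ⟨i, hi, lt_max_of_lt_right (by linarith)⟩
  obtain ⟨δ, hδ, hle⟩ := (isCompact_sphere (0 : V) 1).exists_forall_le'
    (f := fun w => ∑ i ∈ s, max 0 (-(a i w))) (by fun_prop) hpos
  refine hcont.exists_forall_le (tendsto_atTop_mono (f := fun w : V => δ * ‖w‖) (fun w => ?_) ?_)
  · refine le_trans ?_ (Finset.sum_le_sum fun i _ => max_zero_le_log_one_add_exp (-(a i w)))
    rcases eq_or_ne w 0 with rfl | hw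
    · simp
    have hw' : 0 < ‖w‖ := norm_pos_iff.2 hw
    have := hle (‖w‖⁻¹ • w) (by simp [norm_smul, hw'.ne'])
    calc δ * ‖w‖ ≤ (∑ i ∈ s, max 0 (-(a i (‖w‖⁻¹ • w)))) * ‖w‖ := by gcongr
      _ = ∑ i ∈ s, max 0 (-(a i w)) := by
        rw [Finset.sum_mul]
        refine Finset.sum_congr rfl fun i _ => ?_
        rw [max_mul_of_nonneg _ _ hw'.le, map_smul, smul_eq_mul]
        congr 1
        · simp
        · field_simp
  · exact tendsto_norm_cocompact_atTop.const_mul_atTop hδ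

theorem hasMLE_and_hasMLEIntercept {ι : Type*} {d : ℕ} (s : Finset ι)
    (x : ι → EuclideanSpace ℝ (Fin d)) (y : ι → ℝ)
    (h : ∀ b β, (b, β) ≠ 0 → ∃ i ∈ s, y i * (b + inner ℝ (x i) β) < 0) :
    HasMLE s x y ∧ HasMLEIntercept s x y := by
  constructor
  · obtain ⟨β, hβ⟩ := exists_forall_logisticLoss_le s (fun i => y i • innerSL ℝ (x i))
      (fun β hβ => by simpa using h 0 β (by simpa using hβ))
    refine ⟨β, fun β' => ?_⟩
    simpa [logLikelihood] using hβ β'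
  · obtain ⟨⟨b, β⟩, hβ⟩ := exists_forall_logisticLoss_le s
      (fun i => y i • (ContinuousLinearMap.fst ℝ ℝ (EuclideanSpace ℝ (Fin d)) +
        (innerSL ℝ (x i)).comp (ContinuousLinearMap.snd ℝ ℝ _)))
      (fun w hw => by simpa [mul_add] using h w.1 w.2 hw)
    refine ⟨b, β, fun b' β' => ?_⟩
    simpa [logLikelihood, mul_add] using hβ (b', β')

/-! ### Sign patterns of affine functions -/

section SignPatterns

variable {ι E : Type*} [Fintype ι] [NormedAddCommGroup E] [InnerProductSpace ℝ E]

/-- The sets of indices cut out of the points `x i` by open half-spaces whose boundary contains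
none of these points. -/
noncomputable def signPatterns (x : ι → E) : Finset (Finset ι) :=
  open Classical in {A | ∃ (b : ℝ) (β : E), ∀ i,
    (i ∈ A → 0 < b + inner ℝ (x i) β) ∧ (i ∉ A → b + inner ℝ (x i) β < 0)}

theorem mem_signPatterns {x : ι → E} {A : Finset ι} :
    A ∈ signPatterns x ↔ ∃ (b : ℝ) (β : E), ∀ i,
      (i ∈ A → 0 < b + inner ℝ (x i) β) ∧ (i ∉ A → b + inner ℝ (x i) β < 0) := by
  simp [signPatterns]

theorem isOpen_setOf_mem_signPatterns (A : Finset ι) :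
    IsOpen {x : ι → E | A ∈ signPatterns x} := by
  simp only [mem_signPatterns, Set.ofPred_exists, Set.ofPred_forall, Set.ofPred_and]
  refine isOpen_iUnion fun b => isOpen_iUnion fun β => isOpen_iInter_of_finite fun i => ?_
  refine IsOpen.inter ?_ ?_
  · by_cases hi : i ∈ A
    · simpa [hi] using isOpen_lt continuous_const (by fun_prop)
    · simp [hi]
  · by_cases hi : i ∈ A
    · simp [hi]
    · simpa [hi] using isOpen_lt (by fun_prop) continuous_const

/-- Radon's argument: beyond dimension `finrank ℝ E + 1` the vectors `(1, x i)` have a linear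
relation `c`. Shattering yields an affine function whose signs on `S` agree with those of `c`, so
the sum of `c i` times its values is both zero and positive. -/
theorem card_le_of_shatters_signPatterns [DecidableEq ι] [FiniteDimensional ℝ E] {x : ι → E}
    {S : Finset ι} (hS : (signPatterns x).Shatters S) : S.card ≤ Module.finrank ℝ E + 1 := by
  by_contra! hcard
  have hdep : ¬ LinearIndepOn ℝ (fun i => ((1 : ℝ), x i)) (S : Set ι) := fun hli => by
    have := LinearIndependent.fintype_card_le_finrank hli
    simp at this
    omega
  obtain ⟨c, hc, i₀, hi₀, hne⟩ : ∃ c : ι → ℝ, ∑ i ∈ S, c i • ((1 : ℝ), x i) = 0 ∧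
      ∃ i ∈ S, c i ≠ 0 := by
    rw [linearIndepOn_finset_iff] at hdep
    push Not at hdep
    exact hdep
  obtain ⟨A, hA, hSA⟩ := hS (Finset.filter_subset (fun i => 0 < c i) S)
  obtain ⟨b, β, hb⟩ := mem_signPatterns.1 hA
  have hsum : ∑ i ∈ S, c i * (b + inner ℝ (x i) β) = 0 := by
    have h1 : ∑ i ∈ S, c i = 0 := by simpa [Prod.fst_sum] using congrArg Prod.fst hc
    have h2 : ∑ i ∈ S, c i • x i = 0 := by simpa [Prod.snd_sum] using congrArg Prod.snd hc
    have h3 : ∑ i ∈ S, c i * inner ℝ (x i) β = inner ℝ (∑ i ∈ S, c i • x i) β := by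
      simp [sum_inner, real_inner_smul_left]
    simp only [mul_add, Finset.sum_add_distrib, h3, h2, ← Finset.sum_mul, h1, inner_zero_left]
    simp
  have hmem : ∀ i ∈ S, (i ∈ A ↔ 0 < c i) := fun i hi => by
    have := congrArg (i ∈ ·) hSA
    simpa [hi] using this
  have hpos : ∀ i ∈ S, c i ≠ 0 → 0 < c i * (b + inner ℝ (x i) β) := fun i hi h0 => by
    by_cases hiA : i ∈ A
    · exact mul_pos ((hmem i hi).1 hiA) ((hb i).1 hiA)
    · refine mul_pos_of_neg_of_neg (lt_of_le_of_ne ?_ h0) ((hb i).2 hiA)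
      exact not_lt.1 fun h => hiA ((hmem i hi).2 h)
  refine (Finset.sum_pos' (fun i hi => ?_) ⟨i₀, hi₀, hpos i₀ hi₀ hne⟩).ne' hsum
  by_cases h0 : c i = 0
  · simp [h0]
  · exact (hpos i hi h0).le

theorem card_signPatterns_le [FiniteDimensional ℝ E] (x : ι → E) :
    (signPatterns x).card ≤
      (Module.finrank ℝ E + 2) * (Fintype.card ι + 1) ^ (Module.finrank ℝ E + 1) := by
  classical
  set D := Module.finrank ℝ E + 1 with hD
  have hvc : (signPatterns x).vcDim ≤ D :=
    Finset.sup_le fun S hS => card_le_of_shatters_signPatterns (Finset.mem_shatterer.1 hS)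
  calc (signPatterns x).card
      ≤ ∑ k ∈ Finset.Iic (signPatterns x).vcDim, (Fintype.card ι).choose k :=
        (Finset.card_le_card_shatterer _).trans Finset.card_shatterer_le_sum_vcDim
    _ ≤ ∑ k ∈ Finset.Iic D, (Fintype.card ι).choose k :=
        Finset.sum_le_sum_of_subset (Finset.Iic_subset_Iic.2 hvc)
    _ ≤ ∑ _k ∈ Finset.Iic D, (Fintype.card ι + 1) ^ D := by
        refine Finset.sum_le_sum fun k hk => ((Nat.choose_le_pow _ _).trans
          (Nat.pow_le_pow_left (Nat.le_succ _) k)).trans ?_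
        exact Nat.pow_le_pow_right (Nat.succ_pos _) (Finset.mem_Iic.1 hk)
    _ = _ := by simp [hD]

/-- Points in general position: at most `dim E + 1` of them are always affinely independent. -/
def GeneralPosition (x : ι → E) : Prop :=
  ∀ S : Finset ι, S.card ≤ Module.finrank ℝ E + 1 →
    LinearIndepOn ℝ (fun i => ((1 : ℝ), x i)) (S : Set ι)

/-- With too many zeros, `finrank ℝ E + 1` of the vectors `(1, x i)` would form a basis of `ℝ × E`
on which the functional `(b, β)` vanishes. -/
theorem GeneralPosition.linearIndepOn_zeros [FiniteDimensional ℝ E] {x : ι → E}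
    (hx : GeneralPosition x) {b : ℝ} {β : E} (hb : (b, β) ≠ 0) :
    LinearIndepOn ℝ (fun i => ((1 : ℝ), x i)) {i | b + inner ℝ (x i) β = 0} := by
  classical
  have hcard : (Finset.univ.filter fun i => b + inner ℝ (x i) β = 0).card ≤
      Module.finrank ℝ E + 1 := by
    by_contra! hlt
    obtain ⟨S, hS, hcard⟩ := Finset.exists_subset_card_eq hlt.le
    have hli := hx S hcard.le
    have hspan := LinearIndependent.span_eq_top_of_card_eq_finrank' hli (by simp [hcard, add_comm])
    let φ : ℝ × E →ₗ[ℝ] ℝ := b • LinearMap.fst ℝ ℝ E + (innerₗ E β).comp (LinearMap.snd ℝ ℝ E)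
    have hφ : φ = 0 := by
      refine LinearMap.ext_on_range hspan fun i => ?_
      have := (Finset.mem_filter.1 (hS i.2)).2
      simpa [φ, real_inner_comm] using this
    have h1 : b = 0 := by simpa [φ] using LinearMap.congr_fun hφ (1, 0)
    have h2 : β = 0 := by simpa [φ] using LinearMap.congr_fun hφ (0, β)
    exact hb (by simp [h1, h2])
  simpa using hx _ hcard

/-- In general position, a nonzero affine function can be perturbed so that it keeps its signs at
the points where it does not vanish and gets prescribed signs at the points where it does. -/
theorem GeneralPosition.exists_signPattern [FiniteDimensional ℝ E] {x : ι → E}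
    (hx : GeneralPosition x) {b : ℝ} {β : E} (hb : (b, β) ≠ 0) (P : ι → Prop) :
    ∃ A ∈ signPatterns x, ∀ i, i ∈ A ↔
      0 < b + inner ℝ (x i) β ∨ b + inner ℝ (x i) β = 0 ∧ P i := by
  classical
  have hli : LinearIndependent ℝ
      fun i : {i // b + inner ℝ (x i) β = 0} => ((1 : ℝ), x i) := hx.linearIndepOn_zeros hb
  -- Independence at the zeros allows arbitrary values there. Adding a small positive multiple of
  -- `ψ` settles the signs at the zeros and disturbs no other sign.
  obtain ⟨ψ, hψ⟩ : ∃ ψ : ℝ × E →ₗ[ℝ] ℝ, ∀ i, b + inner ℝ (x i) β = 0 →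
      ψ (1, x i) = if P i then 1 else -1 := by
    obtain ⟨ψ, hψ⟩ := LinearMap.exists_extend
      ((Module.Basis.span hli).constr ℝ fun i => if P i.1 then (1 : ℝ) else -1)
    refine ⟨ψ, fun i hi => ?_⟩
    have h1 := LinearMap.congr_fun hψ ((Module.Basis.span hli) ⟨i, hi⟩)
    rw [Module.Basis.constr_basis] at h1
    rwa [LinearMap.comp_apply, Submodule.subtype_apply, Module.Basis.span_apply] at h1
  obtain ⟨u, hu⟩ : ∃ u : E, ∀ v, ψ (0, v) = inner ℝ v u := by
    refine ⟨(InnerProductSpace.toDual ℝ E).symm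
      (LinearMap.toContinuousLinearMap (ψ.comp (LinearMap.inr ℝ ℝ E))), fun v => ?_⟩
    rw [real_inner_comm, InnerProductSpace.toDual_symm_apply]
    simp
  set a := ψ (1, 0) with ha
  have hψ' : ∀ i, ψ (1, x i) = a + inner ℝ (x i) u := fun i => by
    rw [ha, ← hu, ← map_add]; simp
  have hlim : ∀ i, Tendsto (fun r : ℝ => b + inner ℝ (x i) β + r * ψ (1, x i)) (𝓝[>] 0)
      (𝓝 (b + inner ℝ (x i) β)) := fun i => by
    have : Continuous fun r : ℝ => b + inner ℝ (x i) β + r * ψ (1, x i) := by fun_prop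
    simpa using (this.tendsto 0).mono_left nhdsWithin_le_nhds
  have hev : ∀ᶠ r : ℝ in 𝓝[>] 0, ∀ i,
      ((0 < b + inner ℝ (x i) β ∨ b + inner ℝ (x i) β = 0 ∧ P i) →
        0 < b + inner ℝ (x i) β + r * ψ (1, x i)) ∧
      (¬ (0 < b + inner ℝ (x i) β ∨ b + inner ℝ (x i) β = 0 ∧ P i) →
        b + inner ℝ (x i) β + r * ψ (1, x i) < 0) := by
    refine eventually_all.2 fun i => ?_
    rcases lt_trichotomy (b + inner ℝ (x i) β) 0 with h | h | h
    · filter_upwards [(hlim i).eventually_lt_const h] with r hr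
      exact ⟨fun h' => by rcases h' with h' | h' <;> linarith, fun _ => hr⟩
    · filter_upwards [self_mem_nhdsWithin] with r hr
      have hr : 0 < r := hr
      rw [hψ i h, h]
      by_cases hP : P i <;> simp [hP, hr]
    · filter_upwards [(hlim i).eventually_const_lt h] with r hr
      exact ⟨fun _ => hr, fun h' => absurd (Or.inl h) h'⟩
  obtain ⟨r, hr⟩ := hev.exists
  refine ⟨Finset.univ.filter fun i => 0 < b + inner ℝ (x i) β ∨ b + inner ℝ (x i) β = 0 ∧ P i,
    mem_signPatterns.2 ⟨b + r * a, β + r • u, fun i => ?_⟩, by simp⟩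
  have : b + r * a + inner ℝ (x i) (β + r • u) = b + inner ℝ (x i) β + r * ψ (1, x i) := by
    rw [hψ', inner_add_right, real_inner_smul_right]; ring
  simpa only [Finset.mem_filter, Finset.mem_univ, true_and, this] using hr i

end SignPatterns

/-! ### General position of random points -/

section GeneralPosition

variable {ι E : Type*} [Fintype ι] [NormedAddCommGroup E] [InnerProductSpace ℝ E]
  [FiniteDimensional ℝ E] [MeasurableSpace E] [BorelSpace E]

/-- The slice of `V` at height 1 is an affine subspace, and it is proper because a full slice would
force `V = ⊤`. -/
theorem measure_setOf_one_mem_submodule (ν : Measure E) [ν.IsAddHaarMeasure]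
    (V : Submodule ℝ (ℝ × E)) (hV : Module.finrank ℝ V ≤ Module.finrank ℝ E) :
    ν {v | ((1 : ℝ), v) ∈ V} = 0 := by
  let f : E →ᵃ[ℝ] ℝ × E := (AffineMap.const ℝ E (1 : ℝ)).prod (AffineMap.id ℝ E)
  have hf : ∀ v, f v = (1, v) := fun v => rfl
  refine Measure.addHaar_affineSubspace ν (V.toAffineSubspace.comap f) fun htop => ?_
  have hmem : ∀ v : E, ((1 : ℝ), v) ∈ V := fun v => by
    have : v ∈ V.toAffineSubspace.comap f := htop ▸ AffineSubspace.mem_top ℝ E v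
    simpa [AffineSubspace.mem_comap, hf] using this
  have hVtop : V = ⊤ := by
    refine eq_top_iff.2 fun w _ => ?_
    have : w = w.1 • ((1 : ℝ), (0 : E)) + (((1 : ℝ), w.2) - ((1 : ℝ), (0 : E))) := by
      ext <;> simp
    rw [this]
    exact V.add_mem (V.smul_mem _ (hmem 0)) (V.sub_mem (hmem _) (hmem 0))
  subst hVtop
  simp at hV

theorem ae_linearIndepOn_pi (F : Measure E) [IsProbabilityMeasure F] (ν : Measure E)
    [ν.IsAddHaarMeasure] (hF : F ≪ ν) (S : Finset ι) (hS : S.card ≤ Module.finrank ℝ E + 1) :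
    ∀ᵐ x ∂Measure.pi fun _ : ι => F,
      LinearIndepOn ℝ (fun i => ((1 : ℝ), x i)) (S : Set ι) := by
  classical
  have hmeas : ∀ S : Finset ι,
      MeasurableSet {x : ι → E | LinearIndepOn ℝ (fun i => ((1 : ℝ), x i)) (S : Set ι)} := by
    intro S
    refine IsOpen.measurableSet ?_
    refine (isOpen_setOfPred_linearIndependent (𝕜 := ℝ) (E := ℝ × E) (ι := (S : Set ι))).preimage
      (f := fun (x : ι → E) (i : (S : Set ι)) => ((1 : ℝ), x i)) (by fun_prop)
  induction S using Finset.induction_on with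
  | empty => simp
  | insert a S ha ih =>
    rw [Finset.card_insert_of_notMem ha] at hS
    have ih := ih (by omega)
    set B : Set (ι → E) := {x | LinearIndepOn ℝ (fun i => ((1 : ℝ), x i)) (S : Set ι)} \
      {x | LinearIndepOn ℝ (fun i => ((1 : ℝ), x i)) ((insert a S : Finset ι) : Set ι)} with hB
    have hBmeas : MeasurableSet B := (hmeas S).diff (hmeas _)
    have hnull : (Measure.pi fun _ : ι => F) B = 0 := by
      rw [← lintegral_indicator_one hBmeas, ← lintegral_zero (μ := Measure.pi fun _ : ι => F)]
      -- Fubini in the coordinate `a` alone: with the other points fixed, the new point must avoid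
      -- the slice of a span of dimension at most `finrank ℝ E`.
      refine lintegral_eq_of_lmarginal_eq {a} (measurable_one.indicator hBmeas) measurable_const ?_
      ext1 x
      simp only [lmarginal_singleton, lintegral_zero]
      refine lintegral_eq_zero_of_ae_eq_zero ?_
      set V := Submodule.span ℝ ((fun i => ((1 : ℝ), x i)) '' (S : Set ι)) with hV
      have hVnull : F {v | ((1 : ℝ), v) ∈ V} = 0 := by
        refine hF (measure_setOf_one_mem_submodule ν V ?_)
        have : Module.finrank ℝ V ≤ S.card := by
          rw [hV, ← Finset.coe_image]
          exact (finrank_span_finset_le_card _).trans Finset.card_image_le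
        omega
      filter_upwards [measure_eq_zero_iff_ae_notMem.1 hVnull] with v hv
      refine Set.indicator_of_notMem (fun hmem => hv ?_) _
      have himage : (fun i => ((1 : ℝ), Function.update x a v i)) '' (S : Set ι) =
          (fun i => ((1 : ℝ), x i)) '' (S : Set ι) :=
        Set.image_congr fun i hi => by
          have hne : i ≠ a := fun h => ha (by simpa [h] using hi)
          rw [Function.update_of_ne hne]
      obtain ⟨h1, h2⟩ := hmem
      have h1 : LinearIndepOn ℝ (fun i => ((1 : ℝ), Function.update x a v i)) (S : Set ι) := h1
      have h2 : ¬ LinearIndepOn ℝ (fun i => ((1 : ℝ), Function.update x a v i))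
          ((insert a S : Finset ι) : Set ι) := h2
      rw [Finset.coe_insert, linearIndepOn_insert (by simpa using ha), himage] at h2
      simpa [h1] using h2
    filter_upwards [ih, measure_eq_zero_iff_ae_notMem.1 hnull] with x hx hxB
    by_contra hcon
    exact hxB ⟨hx, hcon⟩

theorem ae_generalPosition (F : Measure E) [IsProbabilityMeasure F] (ν : Measure E)
    [ν.IsAddHaarMeasure] (hF : F ≪ ν) :
    ∀ᵐ x ∂Measure.pi fun _ : ι => F, GeneralPosition x := by
  simp only [GeneralPosition, ae_all_iff]
  refine fun S => ?_
  by_cases hS : S.card ≤ Module.finrank ℝ E + 1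
  · simpa [hS] using ae_linearIndepOn_pi F ν hF S hS
  · simp [hS]

end GeneralPosition

/-! ### Lower tail of the number of occurrences -/

/-- Chernoff bound for the lower tail of a number of independent events of probability `p`. -/
theorem measure_card_mem_le {ι α : Type*} [Fintype ι] [MeasurableSpace α]
    (ν : Measure α) [IsProbabilityMeasure ν] (B : ι → Set α) [∀ i a, Decidable (a ∈ B i)]
    (hB : ∀ i, MeasurableSet (B i)) {p : ℝ} (hp : ∀ i, ν.real (B i) = p) (t : ℕ)
    {l : ℝ} (hl : 0 < l) :
    (Measure.pi fun _ : ι => ν).real {y | (Finset.univ.filter fun i => y i ∈ B i).card ≤ t} ≤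
      Real.exp (l * t - Fintype.card ι * p * (l / (1 + l))) := by
  rcases isEmpty_or_nonempty ι with hι | ⟨⟨i₀⟩⟩
  · refine measureReal_le_one.trans (Real.one_le_exp ?_)
    simp
    positivity
  have hp0 : 0 ≤ p := hp i₀ ▸ measureReal_nonneg
  set q := 1 - Real.exp (-l) with hq
  have hql : l / (1 + l) ≤ q := by
    have h1 : 1 + l ≤ Real.exp l := by linarith [Real.add_one_le_exp l]
    have h2 : Real.exp (-l) ≤ 1 / (1 + l) := by
      rw [Real.exp_neg, ← one_div]
      exact one_div_le_one_div_of_le (by linarith) h1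
    have h3 : l / (1 + l) = 1 - 1 / (1 + l) := by field_simp; ring
    linarith
  -- This is `exp (-l)` on `B i` and `1` elsewhere, written affinely in the indicator so that its
  -- mean is `1 - p * q`.
  let f : ι → α → ℝ := fun i a => 1 - (B i).indicator (fun _ => q) a
  have hf : ∀ i a, f i a = Real.exp (-(l * if a ∈ B i then 1 else 0)) := fun i a => by
    by_cases ha : a ∈ B i <;> simp [f, ha, hq]
  have hint : ∀ i, Integrable (f i) ν := fun i =>
    (integrable_const _).sub ((integrable_const _).indicator (hB i))
  have hmean : ∀ i, ∫ a, f i a ∂ν = 1 - p * q := fun i => by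
    rw [integral_sub (integrable_const _) ((integrable_const _).indicator (hB i)),
      integral_indicator_const _ (hB i), hp]
    simp
  have hprod : ∀ y : ι → α, ∏ i, f i (y i) =
      Real.exp (-(l * (Finset.univ.filter fun i => y i ∈ B i).card)) := fun y => by
    simp only [hf, ← Real.exp_sum, Finset.sum_neg_distrib, ← Finset.mul_sum]
    simp
  have hmarkov := mul_meas_ge_le_integral_of_nonneg
    (μ := Measure.pi fun _ : ι => ν) (f := fun y => ∏ i, f i (y i))
    (Eventually.of_forall fun y => by simp only [hprod]; positivity)
    (Integrable.fintype_prod hint) (Real.exp (-(l * t)))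
  rw [integral_fintype_prod_eq_prod] at hmarkov
  simp only [hprod, hmean, Finset.prod_const, Finset.card_univ] at hmarkov
  have hset : {y : ι → α | Real.exp (-(l * t)) ≤
      Real.exp (-(l * (Finset.univ.filter fun i => y i ∈ B i).card))} =
      {y | (Finset.univ.filter fun i => y i ∈ B i).card ≤ t} := by
    ext y
    simp [hl]
  rw [hset] at hmarkov
  have hpow : (1 - p * q) ^ Fintype.card ι ≤ Real.exp (-(Fintype.card ι * p * (l / (1 + l)))) := by
    have h0 : 0 ≤ 1 - p * q := hmean i₀ ▸ integral_nonneg fun a => by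
      simp only [hf]; positivity
    calc (1 - p * q) ^ Fintype.card ι ≤ Real.exp (-(p * q)) ^ Fintype.card ι :=
          pow_le_pow_left₀ h0 (Real.one_sub_le_exp_neg _) _
      _ = Real.exp (-(Fintype.card ι * p * q)) := by
          rw [← Real.exp_nat_mul]; congr 1; ring
      _ ≤ _ := by gcongr
  rw [sub_eq_add_neg, Real.exp_add, ← inv_mul_le_iff₀ (Real.exp_pos _), ← Real.exp_neg]
  exact hmarkov.trans hpow

/-! ### The probability that some estimate fails to exist -/

theorem allPairsHaveMLE_of_generalPosition {d m n : ℕ} {ω : Data d m n}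
    (hx : GeneralPosition fun i => (ω i).1) {t : ℕ}
    (h : ∀ j k : Fin m, j ≠ k → ∀ A ∈ signPatterns fun i => (ω i).1,
      t < (Finset.univ.filter fun i => (ω i).2 = if i ∈ A then k else j).card)
    {T : Finset (Fin n)} (hT : T.card ≤ t) : AllPairsHaveMLE ω (Finset.univ \ T) := by
  intro j k hjk
  refine hasMLE_and_hasMLEIntercept _ _ _ fun b β hb => ?_
  -- Zeros labelled `j` go into `A` and all others outside it. Ties thus count as correct, and the
  -- points counted in `h` are strictly misclassified.
  obtain ⟨A, hA, hmem⟩ := hx.exists_signPattern hb fun i => (ω i).2 = j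
  obtain ⟨i, hi, hiT⟩ := Finset.exists_mem_notMem_of_card_lt_card (hT.trans_lt (h j k hjk A hA))
  have hi : (ω i).2 = if i ∈ A then k else j := by simpa using hi
  refine ⟨i, ?_, ?_⟩
  · by_cases hiA : i ∈ A <;> simp [pairIndices, hiT, hi, hiA]
  · by_cases hiA : i ∈ A
    · simp only [hiA, if_true] at hi
      have hpos := (hmem i).1 hiA
      simp only [hi, hjk.symm, and_false, or_false] at hpos
      rw [show response ω j i = -1 by simp [response, hi, hjk.symm]]
      linarith
    · simp only [hiA, if_false] at hi
      have hneg := mt (hmem i).2 hiA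
      simp only [hi, and_true, not_or] at hneg
      have := lt_of_le_of_ne (not_lt.1 hneg.1) hneg.2
      simpa [response, hi] using this

/-- The sum is the expected number of patterns. A union bound over all `2 ^ n` sets `A` therefore
costs only a polynomial factor, since pattern and label events are independent. -/
theorem sum_measure_mem_signPatterns_le {d n : ℕ}
    (μ : Measure (Fin n → EuclideanSpace ℝ (Fin d))) [IsProbabilityMeasure μ] :
    ∑ A : Finset (Fin n), μ {x | A ∈ signPatterns x} ≤
      (((d + 2) * (n + 1) ^ (d + 1) : ℕ) : ENNReal) := by
  have hmeas := fun A : Finset (Fin n) =>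
    (isOpen_setOf_mem_signPatterns (E := EuclideanSpace ℝ (Fin d)) A).measurableSet
  calc ∑ A : Finset (Fin n), μ {x | A ∈ signPatterns x}
      = ∫⁻ x, ∑ A : Finset (Fin n), {x | A ∈ signPatterns x}.indicator 1 x ∂μ := by
        rw [lintegral_finsetSum _ fun A _ => measurable_one.indicator (hmeas A)]
        exact Finset.sum_congr rfl fun A _ => (lintegral_indicator_one (hmeas A)).symm
    _ ≤ ∫⁻ _, (((d + 2) * (n + 1) ^ (d + 1) : ℕ) : ENNReal) ∂μ := by
        refine lintegral_mono fun x => ?_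
        have := card_signPatterns_le x
        simp only [finrank_euclideanSpace, Fintype.card_fin] at this
        classical
        simp only [Set.indicator_apply, Set.mem_ofPred_eq, Pi.one_apply]
        rw [Finset.sum_boole, Finset.filter_univ_mem]
        exact_mod_cast this
    _ = _ := by simp

theorem dataLaw_compl_le {d m n : ℕ} (hm : 1 ≤ m) (F : Measure (EuclideanSpace ℝ (Fin d)))
    [IsProbabilityMeasure F] (hF : F ≪ volume) (t : ℕ) {l : ℝ} (hl : 0 < l) :
    dataLaw F m n {ω | ∀ T : Finset (Fin n), T.card ≤ t → AllPairsHaveMLE ω (Finset.univ \ T)}ᶜ ≤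
      ENNReal.ofReal ((m : ℝ) ^ 2 * ((d + 2) * ((n : ℝ) + 1) ^ (d + 1)) *
        Real.exp (l * t - n / m * (l / (1 + l)))) := by
  have : NeZero m := ⟨by omega⟩
  set ν : Measure (Fin m) := uniformOn Set.univ with hν
  have : IsProbabilityMeasure ν := isProbabilityMeasure_uniformOn Set.finite_univ Set.univ_nonempty
  set μX : Measure (Fin n → EuclideanSpace ℝ (Fin d)) := Measure.pi fun _ => F with hμX
  set μY : Measure (Fin n → Fin m) := Measure.pi fun _ => ν with hμY
  have hmp := measurePreserving_arrowProdEquivProdArrow (EuclideanSpace ℝ (Fin d)) (Fin m) (Fin n)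
    (fun _ => F) (fun _ => ν)
  set p : ℝ := Real.exp (l * t - n / m * (l / (1 + l))) with hp
  let few (A : Finset (Fin n)) (j k : Fin m) : Set (Fin n → Fin m) :=
    {y | (Finset.univ.filter fun i => y i = if i ∈ A then k else j).card ≤ t}
  let bad : Set ((Fin n → EuclideanSpace ℝ (Fin d)) × (Fin n → Fin m)) :=
    {x | ¬ GeneralPosition x} ×ˢ Set.univ ∪
      ⋃ (j : Fin m) (k : Fin m) (A : Finset (Fin n)), {x | A ∈ signPatterns x} ×ˢ few A j k
  have hfew : ∀ A j k, μY (few A j k) ≤ ENNReal.ofReal p := by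
    intro A j k
    have hone : ∀ c : Fin m, ν.real {c} = 1 / m := fun c => by
      simp [Measure.real, hν, uniformOn_univ]
    have := measure_card_mem_le ν (fun i : Fin n => {if i ∈ A then k else j})
      (fun i => MeasurableSet.singleton _) (fun i => hone _) t hl
    simp only [Set.mem_singleton_iff, Fintype.card_fin, mul_one_div] at this
    rw [← ofReal_measureReal]
    exact ENNReal.ofReal_le_ofReal this
  have hbad : (μX.prod μY) bad ≤ ENNReal.ofReal ((m : ℝ) ^ 2 *
      ((d + 2) * ((n : ℝ) + 1) ^ (d + 1)) * p) := by
    have hgp : μX {x | ¬ GeneralPosition x} = 0 := ae_iff.1 (ae_generalPosition F volume hF)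
    calc (μX.prod μY) bad
        ≤ (μX.prod μY) ({x | ¬ GeneralPosition x} ×ˢ Set.univ) + ∑ j, ∑ k, ∑ A,
            (μX.prod μY) ({x | A ∈ signPatterns x} ×ˢ few A j k) := by
          refine (measure_union_le _ _).trans (add_le_add le_rfl ?_)
          refine (measure_iUnion_fintype_le _ _).trans (Finset.sum_le_sum fun j _ => ?_)
          refine (measure_iUnion_fintype_le _ _).trans (Finset.sum_le_sum fun k _ => ?_)
          exact measure_iUnion_fintype_le _ _
      _ = ∑ j, ∑ k, ∑ A, μX {x | A ∈ signPatterns x} * μY (few A j k) := by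
          simp only [Measure.prod_prod, hgp, zero_mul, zero_add]
      _ ≤ ∑ _j : Fin m, ∑ _k : Fin m,
            (((d + 2) * (n + 1) ^ (d + 1) : ℕ) : ENNReal) * ENNReal.ofReal p := by
          refine Finset.sum_le_sum fun j _ => Finset.sum_le_sum fun k _ => ?_
          refine (Finset.sum_le_sum fun A _ => mul_le_mul_right (hfew A j k) _).trans ?_
          rw [← Finset.sum_mul]
          gcongr
          exact sum_measure_mem_signPatterns_le μX
      _ = _ := by
          rw [ENNReal.ofReal_mul (by positivity), ENNReal.ofReal_mul (by positivity)]
          have h1 : ENNReal.ofReal ((m : ℝ) ^ 2) = (m : ENNReal) ^ 2 := by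
            rw [ENNReal.ofReal_pow (by positivity), ENNReal.ofReal_natCast]
          have h2 : ENNReal.ofReal ((d + 2) * ((n : ℝ) + 1) ^ (d + 1)) =
              (((d + 2) * (n + 1) ^ (d + 1) : ℕ) : ENNReal) := by
            rw [← ENNReal.ofReal_natCast]; push_cast; rfl
          rw [h1, h2]
          simp only [Finset.sum_const, Finset.card_univ, Fintype.card_fin, nsmul_eq_mul]
          ring
  refine le_trans ?_ hbad
  -- A measurable equivalence transports the measure of arbitrary sets, so the event need not be
  -- known to be measurable.
  rw [dataLaw, ← hmp.measure_preimage_equiv]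
  refine measure_mono fun ω hω => ?_
  by_contra hgood
  refine hω fun T hT => ?_
  have hgood' : ¬ ((fun i => (ω i).1), fun i => (ω i).2) ∈ bad := hgood
  simp only [bad, few, Set.mem_union, Set.mem_prod, Set.mem_ofPred_eq, Set.mem_univ, and_true,
    Set.mem_iUnion, not_or, not_not, not_exists, not_and, not_le] at hgood'
  exact allPairsHaveMLE_of_generalPosition hgood'.1 (fun j k _ A hA => hgood'.2 j k A hA) hT

theorem tendsto_dataLaw_one {d : ℕ} (F : Measure (EuclideanSpace ℝ (Fin d)))
    [IsProbabilityMeasure F] (hF : F ≪ volume) (m n t : ℕ → ℕ) (hm : ∀ᶠ s in atTop, 1 ≤ m s)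
    {l : ℝ} (hl : 0 < l)
    (hlim : Tendsto (fun s => (m s : ℝ) ^ 2 * ((d + 2) * ((n s : ℝ) + 1) ^ (d + 1)) *
        Real.exp (l * t s - n s / m s * (l / (1 + l)))) atTop (𝓝 0)) :
    Tendsto (fun s => dataLaw F (m s) (n s) {ω | ∀ T : Finset (Fin (n s)), T.card ≤ t s →
      AllPairsHaveMLE ω (Finset.univ \ T)}) atTop (𝓝 1) := by
  have hlim' := ENNReal.tendsto_ofReal hlim
  rw [ENNReal.ofReal_zero] at hlim'
  have hlow := ENNReal.Tendsto.sub (tendsto_const_nhds (x := (1 : ENNReal))) hlim'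
    (Or.inl ENNReal.one_ne_top)
  rw [tsub_zero] at hlow
  have hprob : ∀ᶠ s in atTop, IsProbabilityMeasure (dataLaw F (m s) (n s)) := by
    filter_upwards [hm] with s hs
    have : NeZero (m s) := ⟨by omega⟩
    have : IsProbabilityMeasure (uniformOn (Set.univ : Set (Fin (m s)))) :=
      isProbabilityMeasure_uniformOn Set.finite_univ Set.univ_nonempty
    unfold dataLaw
    infer_instance
  refine tendsto_of_tendsto_of_tendsto_of_le_of_le' hlow tendsto_const_nhds ?_ ?_
  · filter_upwards [hm, hprob] with s hs _
    rw [tsub_le_iff_right]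
    refine le_trans ?_ (add_le_add le_rfl (dataLaw_compl_le hs F hF (t s) hl))
    rw [← measure_univ (μ := dataLaw F (m s) (n s)), ← Set.union_compl_self]
    exact measure_union_le _ _
  · filter_upwards [hprob] with s _ using prob_le_one

/-! ### Asymptotics -/

theorem tendsto_add_one_pow_mul_exp_neg_atTop (k : ℕ) {c : ℝ} (hc : 0 < c) :
    Tendsto (fun u : ℝ => (u + 1) ^ k * Real.exp (-(c * u))) atTop (𝓝 0) := by
  have h : Tendsto (fun u : ℝ => c * (u + 1)) atTop atTop :=
    (tendsto_atTop_add_const_right _ _ tendsto_id).const_mul_atTop hc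
  have := ((Real.tendsto_pow_mul_exp_neg_atTop_nhds_zero k).comp h).const_mul
    (Real.exp c * (c ^ k)⁻¹)
  rw [mul_zero] at this
  refine this.congr fun u => ?_
  have hexp : Real.exp (-(c * u)) = Real.exp c * Real.exp (-(c * (u + 1))) := by
    rw [← Real.exp_add]; congr 1; ring
  have hck : c ^ k ≠ 0 := by positivity
  simp only [Function.comp_apply]
  rw [hexp, mul_pow]
  field_simp

/-- The factor `log (log m)` eventually exceeds any constant `K`, and `logb 2 m` is at least `log
m`. -/
theorem eventually_mul_log_le_of_logb_mul_log_log_le {ε : ℝ} (hε : 0 < ε) {f : ℕ → ℕ}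
    (hf : ∀ᶠ m : ℕ in atTop,
      (1 + ε) * (m : ℝ) * Real.logb 2 (m : ℝ) * Real.log (Real.log (m : ℝ)) ≤ (f m : ℝ)) (K : ℝ) :
    ∀ᶠ m : ℕ in atTop, K * Real.log m ≤ f m / m := by
  have hlog : Tendsto (fun m : ℕ => Real.log m) atTop atTop :=
    Real.tendsto_log_atTop.comp tendsto_natCast_atTop_atTop
  have hloglog := Real.tendsto_log_atTop.comp hlog
  filter_upwards [hf, eventually_ge_atTop 1, hlog.eventually_ge_atTop 0,
    hloglog.eventually_ge_atTop K, hloglog.eventually_ge_atTop 0] with m hm h1 hl hK h0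
  simp only [Function.comp_apply] at hK h0
  have hm0 : (0 : ℝ) < m := by exact_mod_cast h1
  have hlogb : Real.log m ≤ Real.logb 2 m := by
    rw [← Real.log_div_log, le_div_iff₀ (Real.log_pos one_lt_two)]
    exact mul_le_of_le_one_right hl (by linarith [Real.log_two_lt_d9])
  have hlogb0 : 0 ≤ Real.logb 2 m := hl.trans hlogb
  rw [le_div_iff₀ hm0]
  refine le_trans ?_ hm
  calc K * Real.log m * m ≤ Real.log (Real.log m) * Real.logb 2 m * m := by gcongr
    _ = 1 * m * Real.logb 2 m * Real.log (Real.log m) := by ring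
    _ ≤ (1 + ε) * m * Real.logb 2 m * Real.log (Real.log m) := by gcongr; linarith

theorem tendsto_dataLaw_univ {d : ℕ} {ε : ℝ} (hε : 0 < ε)
    (F : Measure (EuclideanSpace ℝ (Fin d))) [IsProbabilityMeasure F] (hF : F ≪ volume)
    {f : ℕ → ℕ} (hf : ∀ᶠ m : ℕ in atTop,
      (1 + ε) * (m : ℝ) * Real.logb 2 (m : ℝ) * Real.log (Real.log (m : ℝ)) ≤ (f m : ℝ)) :
    Tendsto (fun m : ℕ => dataLaw F m (f m) {ω | AllPairsHaveMLE ω Finset.univ})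
      atTop (𝓝 1) := by
  have hmain := tendsto_dataLaw_one F hF (fun m => m) f (fun _ => 0) (eventually_ge_atTop 1)
    one_pos ?_
  · simpa using hmain
  have hq : Tendsto (fun m : ℕ => (f m : ℝ) / m) atTop atTop :=
    tendsto_atTop_mono' _ ((eventually_mul_log_le_of_logb_mul_log_log_le hε hf 1).mono
      fun m h => by simpa only [Function.comp_apply, one_mul] using h)
      (Real.tendsto_log_atTop.comp tendsto_natCast_atTop_atTop)
  have hbound := (((tendsto_add_one_pow_mul_exp_neg_atTop (d + 1) (c := 1 / 4)
    (by norm_num)).comp hq).const_mul ((d : ℝ) + 2))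
  rw [mul_zero] at hbound
  refine squeeze_zero' (Eventually.of_forall fun m => by positivity) ?_ hbound
  -- The label pairs give `m ^ 2` and `f m + 1 ≤ m * (q + 1)` gives `m ^ (d + 1)`. The constant `4 *
  -- (d + 3)` makes their product at most `exp (q / 4)`, half of the available decay `exp (-(q /
  -- 2))`.
  filter_upwards [eventually_mul_log_le_of_logb_mul_log_log_le hε hf (4 * (d + 3)),
    eventually_ge_atTop 1] with m hm h1
  have hm1 : (1 : ℝ) ≤ m := by exact_mod_cast h1
  have hm0 : (0 : ℝ) < m := by linarith
  set q : ℝ := f m / m with hqdef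
  have hq0 : 0 ≤ q := by positivity
  have hfm : (f m : ℝ) = m * q := by rw [hqdef]; field_simp
  have hpow : (m : ℝ) ^ (d + 3) ≤ Real.exp (q / 4) := by
    rw [← Real.exp_log (pow_pos hm0 (d + 3)), Real.log_pow]
    refine Real.exp_le_exp.2 ?_
    push_cast
    linarith
  have hn : (f m : ℝ) + 1 ≤ m * (q + 1) := by rw [hfm]; linarith
  calc (m : ℝ) ^ 2 * ((d + 2) * ((f m : ℝ) + 1) ^ (d + 1)) *
        Real.exp (1 * ((0 : ℕ) : ℝ) - q * (1 / (1 + 1)))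
      ≤ (m : ℝ) ^ 2 * ((d + 2) * (m * (q + 1)) ^ (d + 1)) *
        Real.exp (1 * ((0 : ℕ) : ℝ) - q * (1 / (1 + 1))) := by gcongr
    _ = (d + 2) * ((q + 1) ^ (d + 1) * ((m : ℝ) ^ (d + 3) * Real.exp (-(q / 2)))) := by
        rw [mul_pow, show (1 : ℝ) * ((0 : ℕ) : ℝ) - q * (1 / (1 + 1)) = -(q / 2) by
          push_cast; ring]
        ring
    _ ≤ (d + 2) * ((q + 1) ^ (d + 1) * (Real.exp (q / 4) * Real.exp (-(q / 2)))) := by gcongr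
    _ = (d + 2) * ((q + 1) ^ (d + 1) * Real.exp (-(1 / 4 * q))) := by
        rw [← Real.exp_add]; ring_nf

theorem tendsto_dataLaw_sdiff {d : ℕ} {ε : ℝ} (hε : 0 < ε)
    (F : Measure (EuclideanSpace ℝ (Fin d))) [IsProbabilityMeasure F] (hF : F ≪ volume)
    {m : ℕ} (hm : 1 ≤ m) {g : ℕ → ℕ}
    (hg : ∀ᶠ t : ℕ in atTop, (1 + ε) * (t : ℝ) ≤ (g t : ℝ) / (m : ℝ)) :
    Tendsto (fun t : ℕ => dataLaw F m (g t) {ω | ∀ T : Finset (Fin (g t)), T.card ≤ t →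
      AllPairsHaveMLE ω (Finset.univ \ T)}) atTop (𝓝 1) := by
  refine tendsto_dataLaw_one F hF (fun _ => m) g (fun t => t) (Eventually.of_forall fun _ => hm)
    (half_pos hε) ?_
  have hm0 : (0 : ℝ) < m := by exact_mod_cast hm
  have hm1 : (1 : ℝ) ≤ m := by exact_mod_cast hm
  -- Since `t ≤ (g t / m) / (1 + ε)` eventually, the exponent is at most `-c * (g t / m)`, and any
  -- positive `l` below `ε` makes `c` positive.
  set l := ε / 2 with hl
  have hl0 : 0 < l := half_pos hε
  set c := l / (1 + l) - l / (1 + ε) with hcdef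
  have hc : 0 < c := sub_pos.2 (div_lt_div_of_pos_left hl0 (by linarith) (by linarith))
  have hgtop : Tendsto (fun t => (g t : ℝ)) atTop atTop := by
    refine tendsto_atTop_mono' _ ?_ tendsto_natCast_atTop_atTop
    filter_upwards [hg] with t ht
    rw [le_div_iff₀ hm0] at ht
    have h0 : (0 : ℝ) ≤ t := t.cast_nonneg
    nlinarith [mul_nonneg hε.le h0, mul_nonneg (mul_nonneg hε.le h0) hm0.le,
      mul_le_mul_of_nonneg_left hm1 h0]
  have hbound := (((tendsto_add_one_pow_mul_exp_neg_atTop (d + 1)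
    (div_pos hc hm0)).comp hgtop).const_mul ((m : ℝ) ^ 2 * (d + 2)))
  rw [mul_zero] at hbound
  refine squeeze_zero' (Eventually.of_forall fun t => by positivity) ?_ hbound
  filter_upwards [hg] with t ht
  have hexp : l * t - g t / m * (l / (1 + l)) ≤ -(c / m * g t) := by
    have h1 : l * t ≤ l / (1 + ε) * (g t / m) := by
      calc l * t = l / (1 + ε) * ((1 + ε) * t) := by field_simp
        _ ≤ _ := by gcongr
    have h2 : c / m * g t = g t / m * (l / (1 + l)) - l / (1 + ε) * (g t / m) := by
      rw [hcdef]; ring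
    linarith
  calc (m : ℝ) ^ 2 * ((d + 2) * ((g t : ℝ) + 1) ^ (d + 1)) *
        Real.exp (l * t - g t / m * (l / (1 + l)))
      ≤ (m : ℝ) ^ 2 * ((d + 2) * ((g t : ℝ) + 1) ^ (d + 1)) * Real.exp (-(c / m * g t)) := by
        gcongr
    _ = _ := by simp only [Function.comp_apply]; ring

end OneVsOne

theorem theorem1p1 (d : ℕ) (ε : ℝ) (hε : 0 < ε)
    (F : Measure (EuclideanSpace ℝ (Fin d))) [IsProbabilityMeasure F]
    (hcont : F ≪ volume) (hsymm : OneVsOne.CentrallySymmetric F) :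
    (∀ f : ℕ → ℕ,
      (∀ᶠ m : ℕ in atTop,
        (1 + ε) * (m : ℝ) * Real.logb 2 (m : ℝ) * Real.log (Real.log (m : ℝ)) ≤ (f m : ℝ)) →
      Tendsto
        (fun m : ℕ => OneVsOne.dataLaw F m (f m)
          {ω | OneVsOne.AllPairsHaveMLE ω Finset.univ})
        atTop (𝓝 1)) ∧
    (∀ m : ℕ, 1 ≤ m → ∀ g : ℕ → ℕ,
      (∀ᶠ t : ℕ in atTop, (1 + ε) * (t : ℝ) ≤ (g t : ℝ) / (m : ℝ)) →
      Tendsto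
        (fun t : ℕ => OneVsOne.dataLaw F m (g t)
          {ω | ∀ T : Finset (Fin (g t)), T.card ≤ t →
            OneVsOne.AllPairsHaveMLE ω (Finset.univ \ T)})
        atTop (𝓝 1)) := by
  exact ⟨fun f hf => OneVsOne.tendsto_dataLaw_univ hε F hcont hf,
    fun m hm g hg => OneVsOne.tendsto_dataLaw_sdiff hε F hcont hm hg⟩
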